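/- For a finite simple graph $G$ let $D(G)$ be its diagonal matrix of vertex degrees and $A(G)$ its adjacency matrix, and let $\rho_{1/2}(G)$ be the largest eigenvalue of $A_{1/2}(G)=\tfrac12 D(G)+\tfrac12 A(G)$ (half the signless Laplacian of $G$). For integers $n\ge 2$ and $n-1\le m\le \binom n2$, let $k$ be the largest integer with $0\le k\le n-1$ and $\sum_{i=1}^{k}(n-i)\le m$, put $a=m-\sum_{i=1}^{k}(n-i)$, and let $$S_{n,m}=K_k\vee\bigl(K_{1,a}\cup (n-a-k-1)K_1\bigr),$$ where $\cup$ denotes disjoint union, $\vee$ denotes the join (disjoint union together with all edges between the two parts), and $K_{1,0}=K_1$. Theorem. Let $n\ge 4$ and $m=2n-2$. Let $G'$ be a simple graph (connected or not) with $n$ vertices and $m$ edges such that $\rho_{1/2}(H)\le\rho_{1/2}(G')$ for every simple graph $H$ (connected or not) with $n$ vertices and $m$ edges. If $n=6$, then $G'\cong K_5\cup K_1$; if $n\neq 6$, then $G'\cong S_{n,2n-2}$. -/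

import Mathlib

namespace AlphaSpectral

open Classical in
/-- The matrix `A_α(G) = α D(G) + (1 - α) A(G)`, where `D(G)` is the diagonal matrix of degrees
and `A(G)` the adjacency matrix. -/
noncomputable def alphaMatrix {V : Type*} [Fintype V] (α : ℝ) (G : SimpleGraph V) :
    Matrix V V ℝ :=
  α • G.degMatrix ℝ + (1 - α) • G.adjMatrix ℝ

/-- The `A_α`-spectral radius `ρ_α(G)`: the largest (real) eigenvalue of `A_α(G)`. -/
noncomputable def alphaSpectralRadius {V : Type*} [Fintype V] (α : ℝ) (G : SimpleGraph V) : ℝ :=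
  sSup {μ : ℝ | Module.End.HasEigenvalue (alphaMatrix α G).mulVecLin μ}

/-- The supremum in the definition of `alphaSpectralRadius` is attained. -/
theorem alphaSpectralRadius_isGreatest {V : Type*} [Fintype V] [Nonempty V] (α : ℝ)
    (G : SimpleGraph V) :
    IsGreatest {μ : ℝ | Module.End.HasEigenvalue (alphaMatrix α G).mulVecLin μ}
      (alphaSpectralRadius α G) := by
  classical
  have hA : (alphaMatrix α G).IsHermitian := by
    unfold alphaMatrix
    rw [Matrix.IsHermitian, Matrix.conjTranspose_eq_transpose_of_trivial]
    simp [Matrix.transpose_add, Matrix.transpose_smul, SimpleGraph.degMatrix]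
  have hs : {μ : ℝ | Module.End.HasEigenvalue (alphaMatrix α G).mulVecLin μ} =
      Set.range hA.eigenvalues := by
    rw [← hA.spectrum_real_eq_range_eigenvalues, ← Matrix.spectrum_toLin']
    ext μ
    exact Module.End.hasEigenvalue_iff_mem_spectrum
  have hne : (Set.range hA.eigenvalues).Nonempty := Set.range_nonempty _
  unfold alphaSpectralRadius
  rw [hs]
  exact ⟨hne.csSup_mem (Set.finite_range _), fun x hx => le_csSup (Set.finite_range _).bddAbove hx⟩

/-- `G` is a graph with `m` edges whose `A_α`-spectral radius is maximum among all graphs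
(connected or not) with `m` edges on the same vertex set. -/
def IsMaximizer {V : Type*} [Fintype V] (α : ℝ) (m : ℕ) (G : SimpleGraph V) : Prop :=
  G.edgeSet.ncard = m ∧
    ∀ H : SimpleGraph V, H.edgeSet.ncard = m → alphaSpectralRadius α H ≤ alphaSpectralRadius α G

/-- The join `G ∨ H`: the disjoint union of `G` and `H` together with all edges between them. -/
def join {V W : Type*} (G : SimpleGraph V) (H : SimpleGraph W) : SimpleGraph (V ⊕ W) :=
  (G ⊕g H) ⊔ completeBipartiteGraph V W

/-- The largest `k < n` (for `n ≥ 1`) with `∑ i = 1, …, k of (n - i)` at most `m`. -/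
def quasiStarK (n m : ℕ) : ℕ :=
  Nat.findGreatest (fun k => ∑ i ∈ Finset.Icc 1 k, (n - i) ≤ m) (n - 1)

/-- The number `a = m - ∑ i = 1, …, k of (n - i)` with `k = quasiStarK n m`. -/
def quasiStarA (n m : ℕ) : ℕ :=
  m - ∑ i ∈ Finset.Icc 1 (quasiStarK n m), (n - i)

/-- The quasi-star graph `S_{n,m} = K_k ∨ (K_{1,a} ∪ (n - a - k - 1) K_1)`
(meaningful for `1 ≤ n` and `n - 1 ≤ m ≤ n (n - 1) / 2`). -/
def quasiStar (n m : ℕ) :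
    SimpleGraph (Fin (quasiStarK n m) ⊕
      ((Fin 1 ⊕ Fin (quasiStarA n m)) ⊕ Fin (n - quasiStarA n m - quasiStarK n m - 1))) :=
  join (⊤ : SimpleGraph (Fin (quasiStarK n m)))
    (completeBipartiteGraph (Fin 1) (Fin (quasiStarA n m)) ⊕g
      (⊥ : SimpleGraph (Fin (n - quasiStarA n m - quasiStarK n m - 1))))

end AlphaSpectral

namespace AlphaSpectral

section
open scoped Classical
open Finset

variable {V : Type*} [Fintype V]

/-! The proof compares a lower and an upper bound for the largest eigenvalue of `2 A_{1/2} = D + A`.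
For the lower bound, `K_2 ∨ (K_2 ∪ (n-4) K_1)` (`twoHubs`) has `2n-2` edges, and an explicit cubic
has among its roots eigenvalues of that graph. Wherever the cubic is negative at some `q ≥ 4`, a
maximizer therefore has radius above `q/2` (`IsMaximizer.lt_radius`).

For the upper bound, a Collatz–Wielandt estimate is applied with the degrees as weights, raised by
`t` at the vertices of one chosen degree (`alphaSpectralRadius_half_le_of_degree`). Each row then
only involves the degree `d` of a vertex and the sum of its neighbours' degrees, which
`neighborDegreeSum_bounds` controls.

Two dominating vertices and `2n-2` edges already force `twoHubs` (`exists_eq_twoHubs`). For `n ≥ 5`,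
`n ≠ 6`, a graph with an isolated vertex or with at most one dominating vertex has radius at most
`q/2` for a `q` where the cubic is negative, or has too few edges. For `n = 6`, an isolated vertex
forces `K_5 ∪ K_1`, of radius at least 4, and all other graphs stay below 4. For `n = 4` the only
graph is `K_4`. -/

/-! ### Test-vector bounds for the largest eigenvalue. -/

theorem alphaMatrix_half_mulVecLin (G : SimpleGraph V) (x : V → ℝ) (v : V) :
    (alphaMatrix (1 / 2 : ℝ) G).mulVecLin x v =
      (G.degree v * x v + ∑ w ∈ G.neighborFinset v, x w) / 2 := by
  simp only [alphaMatrix, Matrix.mulVecLin_apply, Matrix.add_mulVec, Matrix.smul_mulVec,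
    Pi.add_apply, Pi.smul_apply, SimpleGraph.adjMatrix_mulVec_apply, smul_eq_mul]
  rw [SimpleGraph.degMatrix, Matrix.mulVec_diagonal]
  ring

/-- An upper bound of Collatz–Wielandt type. -/
theorem alphaSpectralRadius_half_le [Nonempty V] (G : SimpleGraph V) (c : ℝ) (w : V → ℝ)
    (hw : ∀ v, 0 < w v)
    (h : ∀ v, G.degree v * w v + ∑ u ∈ G.neighborFinset v, w u ≤ c * w v) :
    alphaSpectralRadius (1 / 2 : ℝ) G ≤ c / 2 := by
  have hev := (alphaSpectralRadius_isGreatest (1 / 2 : ℝ) G).1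
  set μ := alphaSpectralRadius (1 / 2 : ℝ) G
  obtain ⟨x, hx⟩ := Module.End.HasEigenvalue.exists_hasEigenvector hev
  -- At a vertex maximizing `|x| / w`, the absolute value of the eigenvalue equation is dominated by
  -- the row inequality for `w`.
  obtain ⟨v, hv⟩ := Finite.exists_max fun v => |x v| / w v
  have hμ : μ * x v = (G.degree v * x v + ∑ u ∈ G.neighborFinset v, x u) / 2 := by
    rw [← alphaMatrix_half_mulVecLin, hx.apply_eq_smul, Pi.smul_apply, smul_eq_mul]
  set r := |x v| / w v with hr
  have hxr : ∀ u, |x u| ≤ r * w u := fun u => (div_le_iff₀ (hw u)).1 (hv u)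
  have hxv : |x v| = r * w v := by rw [hr, div_mul_cancel₀ _ (hw v).ne']
  have hr0 : 0 < r := by
    by_contra hneg
    refine hx.2 (funext fun u => ?_)
    have := (hxr u).trans (mul_nonpos_of_nonpos_of_nonneg (not_lt.1 hneg) (hw u).le)
    exact abs_eq_zero.1 (le_antisymm this (abs_nonneg _))
  have h1 : μ * |x v| ≤ (G.degree v * |x v| + ∑ u ∈ G.neighborFinset v, |x u|) / 2 := by
    calc μ * |x v| ≤ |μ| * |x v| := by gcongr; exact le_abs_self _
      _ = |(G.degree v * x v + ∑ u ∈ G.neighborFinset v, x u) / 2| := by rw [← abs_mul, hμ]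
      _ = |G.degree v * x v + ∑ u ∈ G.neighborFinset v, x u| / 2 := by
        rw [abs_div, abs_of_pos (by norm_num : (0 : ℝ) < 2)]
      _ ≤ _ := by
        gcongr
        refine (abs_add_le _ _).trans (add_le_add ?_ (abs_sum_le_sum_abs _ _))
        rw [abs_mul, Nat.abs_cast]
  have h2 : ∑ u ∈ G.neighborFinset v, |x u| ≤ r * ∑ u ∈ G.neighborFinset v, w u := by
    rw [mul_sum]; exact sum_le_sum fun u _ => hxr u
  have h3 := mul_le_mul_of_nonneg_left (h v) hr0.le
  have h4 : μ * (r * w v) ≤ c / 2 * (r * w v) := by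
    rw [hxv] at h1; nlinarith
  exact le_of_mul_le_mul_right h4 (mul_pos hr0 (hw v))

theorem le_alphaSpectralRadius_half (G : SimpleGraph V) (c : ℝ) (x : V → ℝ)
    (hx : x ≠ 0)
    (h : ∀ v, G.degree v * x v + ∑ u ∈ G.neighborFinset v, x u = c * x v) :
    c / 2 ≤ alphaSpectralRadius (1 / 2 : ℝ) G := by
  obtain ⟨v, -⟩ := Function.ne_iff.1 hx
  have : Nonempty V := ⟨v⟩
  refine (alphaSpectralRadius_isGreatest (1 / 2 : ℝ) G).2 ?_
  refine Module.End.hasEigenvalue_of_hasEigenvector (x := x) ⟨?_, hx⟩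
  rw [Module.End.mem_eigenspace_iff]
  ext u
  rw [alphaMatrix_half_mulVecLin, h, Pi.smul_apply, smul_eq_mul]
  ring

/-! ### Degree weights and neighbour degree sums. -/

/-- The sum of the degrees of the neighbours of a vertex. -/
noncomputable def neighborDegreeSum (G : SimpleGraph V) (v : V) : ℕ :=
  ∑ w ∈ G.neighborFinset v, G.degree w

/-- The upper bound given by the degree weights, with the weight of the vertices of a chosen
degree `D` increased by `t`. -/
theorem alphaSpectralRadius_half_le_of_degree [Nonempty V] (G : SimpleGraph V) (D J : ℕ)
    (t c : ℝ) (ht : 0 ≤ t) (hc : 0 ≤ c) (hD : 0 < D)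
    (hJ : #{v | G.degree v = D} ≤ J)
    (htop : ∀ v, G.degree v = D →
      (D : ℝ) * (D + t) + neighborDegreeSum G v + t * (J - 1) ≤ c * (D + t))
    (hlow : ∀ v, G.degree v ≠ 0 → G.degree v ≠ D →
      (G.degree v : ℝ) * G.degree v + neighborDegreeSum G v + t * J ≤ c * G.degree v) :
    alphaSpectralRadius (1 / 2 : ℝ) G ≤ c / 2 := by
  -- Isolated vertices get weight 1 only because weights must be positive; their rows vanish.
  set w : V → ℝ := fun v =>
    if G.degree v = 0 then 1 else G.degree v + if G.degree v = D then t else 0 with hw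
  have hsum : ∀ v, ∑ u ∈ G.neighborFinset v, w u =
      neighborDegreeSum G v + t * #{u ∈ G.neighborFinset v | G.degree u = D} := by
    intro v
    rw [neighborDegreeSum, Nat.cast_sum, mul_comm t, ← nsmul_eq_mul, ← sum_const, sum_filter,
      ← sum_add_distrib]
    refine sum_congr rfl fun u hu => ?_
    have : G.degree u ≠ 0 := by
      have : 0 < G.degree u :=
        (G.degree_pos_iff_exists_adj u).2 ⟨v, ((G.mem_neighborFinset v u).1 hu).symm⟩
      omega
    simp [hw, this]
  refine alphaSpectralRadius_half_le G c w (fun v => ?_) fun v => ?_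
  · simp only [hw]
    split_ifs with h0 h1
    · exact one_pos
    · have : (0 : ℝ) < G.degree v := by exact_mod_cast Nat.pos_of_ne_zero h0
      linarith
    · have : (0 : ℝ) < G.degree v := by exact_mod_cast Nat.pos_of_ne_zero h0
      linarith
  · rw [hsum]
    by_cases h0 : G.degree v = 0
    · have : G.neighborFinset v = ∅ := card_eq_zero.1 h0
      simp [hw, h0, this, neighborDegreeSum, hc]
    by_cases hv : G.degree v = D
    · have h1 : #{u ∈ G.neighborFinset v | G.degree u = D} + 1 ≤ J := by
        refine le_trans ?_ hJ
        rw [← card_insert_of_notMem (a := v) (by simp)]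
        refine card_le_card fun u hu => ?_
        rcases mem_insert.1 hu with rfl | hu
        · simpa using hv
        · simpa using (mem_filter.1 hu).2
      have h2 : (#{u ∈ G.neighborFinset v | G.degree u = D} : ℝ) ≤ J - 1 := by
        have : ((#{u ∈ G.neighborFinset v | G.degree u = D} + 1 : ℕ) : ℝ) ≤ J := by
          exact_mod_cast h1
        push_cast at this; linarith
      have hwv : w v = D + t := by simp [hw, hv, hD.ne']
      have := htop v hv
      rw [hwv, hv]
      nlinarith [mul_le_mul_of_nonneg_left h2 ht]
    · have h2 : (#{u ∈ G.neighborFinset v | G.degree u = D} : ℝ) ≤ J := by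
        refine Nat.cast_le.2 (le_trans (card_le_card ?_) hJ)
        exact fun u hu => by simpa using (mem_filter.1 hu).2
      have hwv : w v = G.degree v := by simp [hw, hv, h0]
      have := hlow v h0 hv
      rw [hwv]
      nlinarith [mul_le_mul_of_nonneg_left h2 ht]

theorem sum_degree_eq (G : SimpleGraph V) {m : ℕ} (hm : G.edgeSet.ncard = m) :
    ∑ v, G.degree v = 2 * m := by
  rw [G.sum_degrees_eq_twice_card_edges, ← hm, Set.ncard_eq_toFinset_card']
  rfl

/-- In the total degree `2m`, every vertex outside the closed neighbourhood of `v` contributes at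
least `k`. This is the strong bound when `v` has large degree. -/
theorem neighborDegreeSum_add_le (G : SimpleGraph V) {m k : ℕ} (hm : G.edgeSet.ncard = m)
    (hk : ∀ v, k ≤ G.degree v) (v : V) :
    neighborDegreeSum G v + G.degree v + (Fintype.card V - 1 - G.degree v) * k ≤ 2 * m := by
  rw [← sum_degree_eq G hm, neighborDegreeSum]
  have h1 : insert v (G.neighborFinset v) ⊆ univ := subset_univ _
  rw [← sum_sdiff h1, sum_insert (by simp), add_comm (∑ w ∈ G.neighborFinset v, _),
    add_comm (∑ w ∈ _ \ _, _)]
  refine Nat.add_le_add_left ?_ _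
  refine le_trans (le_of_eq ?_) (card_nsmul_le_sum _ _ k fun u _ => hk u)
  rw [card_sdiff_of_subset h1, card_insert_of_notMem (by simp), card_univ,
    G.card_neighborFinset_eq_degree, smul_eq_mul]
  congr 1; omega

/-- Split the degrees over the neighbourhood `N` of `v` into a part inside `N`, at most `d(d-1)`,
and a part leaving `N`. The latter is counted again by the degrees outside `N`, so it fits into `2m`
a second time. -/
theorem two_mul_neighborDegreeSum_le (G : SimpleGraph V) {m : ℕ} (hm : G.edgeSet.ncard = m)
    (v : V) :
    2 * neighborDegreeSum G v ≤ 2 * m + G.degree v * (G.degree v - 1) := by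
  rw [← sum_degree_eq G hm, neighborDegreeSum]
  set N := G.neighborFinset v with hN
  have hdeg : ∀ u, G.degree u = #{x ∈ N | G.Adj u x} + #{x ∈ Nᶜ | G.Adj u x} := by
    intro u
    rw [← card_union_of_disjoint
      (disjoint_filter_filter (disjoint_compl_right : Disjoint N Nᶜ)), ← filter_union,
      union_compl, ← G.card_neighborFinset_eq_degree]
    congr 1; ext x; simp
  have hswap : ∑ u ∈ N, #{x ∈ Nᶜ | G.Adj u x} = ∑ u ∈ Nᶜ, #{x ∈ N | G.Adj u x} := by
    refine (sum_card_bipartiteAbove_eq_sum_card_bipartiteBelow fun u x => G.Adj u x).trans ?_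
    simp only [bipartiteBelow, G.adj_comm]
  have hinner : ∑ u ∈ N, #{x ∈ N | G.Adj u x} ≤ G.degree v * (G.degree v - 1) := by
    rw [← G.card_neighborFinset_eq_degree v, ← smul_eq_mul]
    refine sum_le_card_nsmul _ _ _ fun u hu => ?_
    rw [← card_erase_of_mem hu]
    refine card_le_card fun x hx => ?_
    obtain ⟨hx1, hx2⟩ := mem_filter.1 hx
    exact mem_erase.2 ⟨hx2.ne', hx1⟩
  have h1 : ∑ u ∈ N, G.degree u =
      ∑ u ∈ N, #{x ∈ N | G.Adj u x} + ∑ u ∈ N, #{x ∈ Nᶜ | G.Adj u x} := by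
    rw [← sum_add_distrib]; exact sum_congr rfl fun u _ => hdeg u
  have h2 : ∑ u ∈ Nᶜ, #{x ∈ N | G.Adj u x} ≤ ∑ u ∈ Nᶜ, G.degree u :=
    sum_le_sum fun u _ => by rw [hdeg u]; exact Nat.le_add_right _ _
  have h3 := sum_add_sum_compl N fun u => G.degree u
  omega

theorem neighborDegreeSum_le (G : SimpleGraph V) {b J : ℕ} (hb : ∀ v, G.degree v ≤ b + 1)
    (hJ : #{v | G.degree v = b + 1} ≤ J) (v : V) :
    neighborDegreeSum G v ≤ G.degree v * b + J := by
  have : neighborDegreeSum G v ≤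
      ∑ u ∈ G.neighborFinset v, (b + if G.degree u = b + 1 then 1 else 0) := by
    refine sum_le_sum fun u _ => ?_
    have := hb u
    split_ifs <;> omega
  refine this.trans ?_
  rw [sum_add_distrib, sum_const, smul_eq_mul, ← card_filter, G.card_neighborFinset_eq_degree]
  refine Nat.add_le_add_left ((card_le_card fun u hu => ?_).trans hJ) _
  simpa using (mem_filter.1 hu).2

/-- If every vertex of `F` is adjacent to all other vertices of `U`, there are many edges. -/
theorem card_mul_le_sum_degree (G : SimpleGraph V) {F U : Finset V} (hFU : F ⊆ U)
    (h : ∀ f ∈ F, ∀ u ∈ U, u ≠ f → G.Adj f u) :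
    #F * (#U - 1) + (#U - #F) * #F ≤ ∑ v, G.degree v := by
  have h1 : #F * (#U - 1) ≤ ∑ v ∈ F, G.degree v := by
    refine card_nsmul_le_sum _ _ _ fun f hf => ?_
    rw [← card_erase_of_mem (hFU hf), ← G.card_neighborFinset_eq_degree]
    refine card_le_card fun u hu => ?_
    obtain ⟨h1, h2⟩ := mem_erase.1 hu
    exact (G.mem_neighborFinset _ _).2 (h f hf u h2 h1)
  have h2 : (#U - #F) * #F ≤ ∑ v ∈ U \ F, G.degree v := by
    rw [← card_sdiff_of_subset hFU]
    refine card_nsmul_le_sum _ _ _ fun u hu => ?_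
    obtain ⟨h1, h2⟩ := mem_sdiff.1 hu
    rw [← G.card_neighborFinset_eq_degree]
    refine card_le_card fun f hf => ?_
    exact (G.mem_neighborFinset _ _).2 (h f hf u h1 (fun e => h2 (e ▸ hf))).symm
  have h3 := sum_sdiff (f := fun v => G.degree v) hFU
  have h4 := sum_le_univ_sum_of_nonneg (s := U) (f := fun v => G.degree v) fun _ => Nat.zero_le _
  omega

theorem eq_of_le_of_ncard_edgeSet {G H : SimpleGraph V} (hle : G ≤ H)
    (h : H.edgeSet.ncard = G.edgeSet.ncard) : G = H :=
  SimpleGraph.edgeSet_inj.1 (Set.eq_of_subset_of_ncard_le (SimpleGraph.edgeSet_mono hle) h.le)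

/-! ### The extremal graph `K_2 ∨ (K_2 ∪ (n-4) K_1)`. -/

/-- The graph in which `a` and `b` are adjacent to all vertices, with `cd` as the only other
edge. -/
def twoHubs (a b c d : V) : SimpleGraph V where
  Adj u v := u ≠ v ∧ (u = a ∨ u = b ∨ v = a ∨ v = b ∨ u = c ∧ v = d ∨ u = d ∧ v = c)
  symm := ⟨fun _ _ h => by tauto⟩
  loopless := ⟨fun _ h => h.1 rfl⟩

section twoHubs

variable {a b c d : V}

theorem neighborFinset_twoHubs (h : [a, b, c, d].Nodup) (v : V) :
    (twoHubs a b c d).neighborFinset v =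
      if v = a ∨ v = b then univ.erase v else if v = c then {a, b, d} else
        if v = d then {a, b, c} else {a, b} := by
  simp only [List.nodup_cons, List.mem_cons, List.not_mem_nil] at h
  ext u
  rw [SimpleGraph.mem_neighborFinset]
  split_ifs <;> simp [twoHubs] <;> grind

theorem degree_twoHubs (h : [a, b, c, d].Nodup) (v : V) :
    (twoHubs a b c d).degree v =
      if v = a ∨ v = b then Fintype.card V - 1 else if v = c ∨ v = d then 3 else 2 := by
  rw [← SimpleGraph.card_neighborFinset_eq_degree, neighborFinset_twoHubs h]
  simp only [List.nodup_cons, List.mem_cons, List.not_mem_nil] at h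
  by_cases h1 : v = a ∨ v = b
  · simp [h1]
  by_cases h2 : v = c
  · simp only [h2, if_true, true_or]
    rw [if_neg (by grind), card_eq_three.2 ⟨a, b, d, by grind, by grind, by grind, rfl⟩]
    grind
  by_cases h3 : v = d
  · simp only [h3, if_true, or_true]
    rw [if_neg (by grind), if_neg (by grind),
      card_eq_three.2 ⟨a, b, c, by grind, by grind, by grind, rfl⟩]
    grind
  · simp only [h1, h2, h3, if_false, or_false]
    exact card_pair (by grind)

theorem sum_ite_of_nodup {R : Type*} [CommRing R] (h : [a, b, c, d].Nodup) (x y z : R) :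
    ∑ v, (if v = a ∨ v = b then x else if v = c ∨ v = d then y else z) =
      2 * x + 2 * y + (Fintype.card V - 4) * z := by
  simp only [List.nodup_cons, List.mem_cons, List.not_mem_nil] at h
  have : ∀ v, (if v = a ∨ v = b then x else if v = c ∨ v = d then y else z) =
      z + ((if v = a then x - z else 0) + (if v = b then x - z else 0) +
        (if v = c then y - z else 0) + (if v = d then y - z else 0)) := by
    intro v
    grind
  simp only [this, sum_add_distrib, sum_ite_eq', mem_univ, if_true, sum_const, card_univ,
    nsmul_eq_mul]
  ring

theorem four_le_card_of_nodup (h : [a, b, c, d].Nodup) : 4 ≤ Fintype.card V := by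
  simpa using h.length_le_card

theorem ncard_edgeSet_twoHubs (h : [a, b, c, d].Nodup) :
    (twoHubs a b c d).edgeSet.ncard = 2 * Fintype.card V - 2 := by
  have h1 := sum_degree_eq (twoHubs a b c d) rfl
  have h4 := four_le_card_of_nodup h
  have h2 : ((∑ v, (twoHubs a b c d).degree v : ℕ) : ℤ) = 4 * Fintype.card V - 4 := by
    simp only [degree_twoHubs h, Nat.cast_sum, Nat.cast_ite]
    rw [sum_ite_of_nodup h]
    push_cast [Nat.cast_sub (show 1 ≤ Fintype.card V by omega)]
    ring
  omega

theorem lt_alphaSpectralRadius_twoHubs (h : [a, b, c, d].Nodup) {n : ℕ}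
    (hn : Fintype.card V = n) {q : ℝ} (hq : 4 ≤ q)
    (hp : (q - n) * (q - 4) * (q - 2) - 4 * (q - 2) - 2 * (n - 4) * (q - 4) < 0) :
    q / 2 < alphaSpectralRadius (1 / 2 : ℝ) (twoHubs a b c d) := by
  set p : ℝ → ℝ := fun s => (s - n) * (s - 4) * (s - 2) - 4 * (s - 2) - 2 * (n - 4) * (s - 4)
    with hpdef
  have hn4 : (4 : ℝ) ≤ n := by exact_mod_cast hn ▸ four_le_card_of_nodup h
  -- The cubic is negative at `q` and nonnegative far to the right; a root beyond `q ≥ 4` also keeps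
  -- `r - 4` and `r - 2` nonzero.
  obtain ⟨r, hr⟩ : ∃ r, q < r ∧ p r = 0 := by
    have hcont : ContinuousOn p (Set.Icc q (q + n + 6)) := by fun_prop
    have hpos : 0 ≤ p (q + n + 6) := by
      have : p (q + n + 6) = (q + 2) * (q + n + 2) * (q + n + 4) + 2 * (q + n + 2) * (q + n + 4)
        + 2 * (q + n + 2) * (q + n + 4) - 4 * (q + n + 4) - 2 * (n - 4) * (q + n + 2) := by
        simp only [hpdef]; ring
      rw [this]
      have h2 : (0 : ℝ) ≤ q + n + 2 := by linarith
      have h4 : (0 : ℝ) ≤ q + n + 4 := by linarith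
      nlinarith [mul_nonneg h2 h4, mul_nonneg (mul_nonneg h2 h4) (by linarith : (0 : ℝ) ≤ q)]
    obtain ⟨r, hr1, hr2⟩ := intermediate_value_Icc (by linarith) hcont ⟨hp.le, hpos⟩
    refine ⟨r, lt_of_le_of_ne hr1.1 ?_, hr2⟩
    rintro rfl
    exact hp.ne hr2
  obtain ⟨hqr, hr0⟩ := hr
  refine lt_of_lt_of_le (by linarith : q / 2 < r / 2) ?_
  have hr4 : r - 4 ≠ 0 := by linarith
  have hr2 : r - 2 ≠ 0 := by linarith
  -- With value 1 on the hubs, the rows of `c`, `d` and of the remaining vertices dictate the other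
  -- entries; the hub row is then exactly `p r = 0`.
  set x : V → ℝ := fun v =>
    if v = a ∨ v = b then 1 else if v = c ∨ v = d then 2 / (r - 4) else 2 / (r - 2) with hx
  have hxs : ∑ v, x v = 2 + 2 * (2 / (r - 4)) + (n - 4) * (2 / (r - 2)) := by
    rw [hx, sum_ite_of_nodup h, hn, mul_one]
  refine le_alphaSpectralRadius_half _ r x (fun h0 => by simpa [hx] using congrFun h0 a)
    fun v => ?_
  rw [degree_twoHubs h, neighborFinset_twoHubs h]
  have hd := h
  simp only [List.nodup_cons, List.mem_cons, List.not_mem_nil] at hd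
  have hxa : x a = 1 := by simp [hx]
  have hxb : x b = 1 := by simp [hx]
  have hxc : x c = 2 / (r - 4) := by simp only [hx]; rw [if_neg (by grind), if_pos (by grind)]
  have hxd : x d = 2 / (r - 4) := by simp only [hx]; rw [if_neg (by grind), if_pos (by grind)]
  by_cases h1 : v = a ∨ v = b
  · have hxv : x v = 1 := by simp [hx, h1]
    rw [if_pos h1, if_pos h1, ← sub_eq_iff_eq_add'.2 (add_sum_erase univ x (mem_univ v)).symm,
      hxs, hxv, hn, Nat.cast_sub (by rw [← hn]; have := four_le_card_of_nodup h; omega)]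
    simp only [hpdef] at hr0
    field_simp
    push_cast
    linear_combination -hr0
  by_cases h2 : v = c
  · subst h2
    rw [if_neg h1, if_neg h1, if_pos (Or.inl rfl), if_pos rfl, sum_insert (by grind),
      sum_insert (by grind), sum_singleton, hxa, hxb, hxc, hxd]
    field_simp
    push_cast
    ring
  by_cases h3 : v = d
  · subst h3
    rw [if_neg h1, if_neg h1, if_pos (Or.inr rfl), if_neg h2, if_pos rfl, sum_insert (by grind),
      sum_insert (by grind), sum_singleton, hxa, hxb, hxc, hxd]
    field_simp
    push_cast
    ring
  · have hxv : x v = 2 / (r - 2) := by simp [hx, h1, h2, h3]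
    rw [if_neg h1, if_neg h1, if_neg (by tauto), if_neg h2, if_neg h3, sum_pair (by grind), hxa,
      hxb, hxv]
    field_simp
    push_cast
    ring

end twoHubs

/-- A graph with `2 n - 2` edges and two dominating vertices. -/
theorem exists_eq_twoHubs (G : SimpleGraph V) (hn : 4 ≤ Fintype.card V)
    (hG : G.edgeSet.ncard = 2 * Fintype.card V - 2) {a b : V} (hab : a ≠ b)
    (ha : G.degree a = Fintype.card V - 1) (hb : G.degree b = Fintype.card V - 1) :
    ∃ c d, [a, b, c, d].Nodup ∧ G = twoHubs a b c d := by
  have hadj : ∀ {v : V}, G.degree v = Fintype.card V - 1 → ∀ u, u ≠ v → G.Adj v u := by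
    intro v hv u hu
    have := (G.degree_eq_card_sub_one v).1 hv
    exact this hu.symm
  -- Otherwise the degree sum is at most `2(n-1) + 2(n-2)`, short of `4n-4`.
  obtain ⟨c, hca, hcb, hc⟩ : ∃ c, c ≠ a ∧ c ≠ b ∧ 3 ≤ G.degree c := by
    by_contra! hcon
    have h1 := sum_degree_eq G hG
    rw [← add_sum_erase univ _ (mem_univ a),
      ← add_sum_erase _ _ (mem_erase.2 ⟨hab.symm, mem_univ b⟩)] at h1
    have h2 : ∑ v ∈ (univ.erase a).erase b, G.degree v ≤ #((univ.erase a).erase b) • 2 := by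
      refine sum_le_card_nsmul _ _ _ fun v hv => ?_
      have := hcon v (by grind) (by grind)
      omega
    rw [card_erase_of_mem (by grind), card_erase_of_mem (mem_univ a), card_univ,
      smul_eq_mul] at h2
    omega
  obtain ⟨d, hd, hda⟩ : ∃ d ∈ G.neighborFinset c, d ∉ ({a, b} : Finset V) := by
    refine exists_mem_notMem_of_card_lt_card ?_
    rw [card_pair hab, G.card_neighborFinset_eq_degree]
    omega
  rw [G.mem_neighborFinset] at hd
  have hcd := hd.ne
  have hnd : [a, b, c, d].Nodup := by
    simp only [List.nodup_cons, List.mem_cons, List.not_mem_nil, List.nodup_nil]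
    grind
  refine ⟨c, d, hnd, (eq_of_le_of_ncard_edgeSet ?_ ?_).symm⟩
  · rintro u v ⟨huv, rfl | rfl | rfl | rfl | ⟨rfl, rfl⟩ | ⟨rfl, rfl⟩⟩
    exacts [hadj ha _ huv.symm, hadj hb _ huv.symm, (hadj ha _ huv).symm, (hadj hb _ huv).symm,
      hd, hd.symm]
  · rw [hG, ncard_edgeSet_twoHubs hnd]

/-- The graph `K_k ∨ (K_{1,a} ∪ (n - a - k - 1) K_1)`. -/
def joinStar (n k a : ℕ) :
    SimpleGraph (Fin k ⊕ ((Fin 1 ⊕ Fin a) ⊕ Fin (n - a - k - 1))) :=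
  join (⊤ : SimpleGraph (Fin k))
    (completeBipartiteGraph (Fin 1) (Fin a) ⊕g (⊥ : SimpleGraph (Fin (n - a - k - 1))))

theorem nonempty_twoHubs_iso_joinStar {a b c d : V} (h : [a, b, c, d].Nodup) :
    Nonempty (twoHubs a b c d ≃g joinStar (Fintype.card V) 2 1) := by
  have h4 := four_le_card_of_nodup h
  have hcard : Fintype.card {v // v ∉ ({a, b, c, d} : Finset V)} =
      Fintype.card V - 1 - 2 - 1 := by
    rw [Fintype.card_subtype_compl, Fintype.card_coe]
    have : #({a, b, c, d} : Finset V) = 4 := by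
      simpa using List.toFinset_card_of_nodup h
    omega
  let e := (Fintype.equivFinOfCardEq hcard).symm
  simp only [List.nodup_cons, List.mem_cons, List.not_mem_nil] at h
  let f : Fin 2 ⊕ ((Fin 1 ⊕ Fin 1) ⊕ Fin (Fintype.card V - 1 - 2 - 1)) → V :=
    Sum.elim ![a, b] (Sum.elim (Sum.elim (fun _ => c) (fun _ => d)) fun i => (e i).1)
  have he : ∀ i, (e i).1 ≠ a ∧ (e i).1 ≠ b ∧ (e i).1 ≠ c ∧ (e i).1 ≠ d := fun i => by
    have := (e i).2
    grind
  have h01 : ∀ i : Fin 2, ![a, b] i = a ∧ i = 0 ∨ ![a, b] i = b ∧ i = 1 := fun i => by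
    fin_cases i <;> simp
  have hf : Function.Injective f := by
    rintro (i | (i | i) | i) (j | (j | j) | j) hij <;>
      simp only [f, Sum.elim_inl, Sum.elim_inr] at hij
    all_goals try have := h01 i
    all_goals try have := h01 j
    all_goals try have := he i
    all_goals try have := he j
    any_goals (exfalso; grind)
    · grind
    · rw [Subsingleton.elim i j]
    · rw [Subsingleton.elim i j]
    · rw [e.injective (Subtype.ext hij)]
  have hbij : Function.Bijective f :=
    (Fintype.bijective_iff_injective_and_card f).2 ⟨hf, by simp; omega⟩
  refine ⟨SimpleGraph.Iso.symm ⟨Equiv.ofBijective f hbij, fun {i j} => ?_⟩⟩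
  rw [Equiv.ofBijective_apply, Equiv.ofBijective_apply]
  rcases i with i | (i | i) | i <;> rcases j with j | (j | j) | j <;>
    simp only [f, Sum.elim_inl, Sum.elim_inr, twoHubs, joinStar, join]
  all_goals try have := h01 i
  all_goals try have := h01 j
  all_goals try have := he i
  all_goals try have := he j
  all_goals simp
  any_goals grind

theorem nonempty_top_iso_joinStar (h : Fintype.card V = 4) :
    Nonempty ((⊤ : SimpleGraph V) ≃g joinStar 4 3 0) := by
  have : joinStar 4 3 0 = ⊤ := by
    ext u v
    rcases u with u | (u | u) | u <;> rcases v with v | (v | v) | v <;>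
      simp [joinStar, join] <;> first | exact u.elim0 | exact v.elim0 | omega
  rw [this]
  exact ⟨SimpleGraph.Iso.completeGraph (Fintype.equivOfCardEq (by simp [h]))⟩

/-! ### The graph `K_{n-1} ∪ K_1`. -/

/-- The complete graph on the vertices other than `z`. -/
def cliqueWithIsolated (z : V) : SimpleGraph V where
  Adj u v := u ≠ v ∧ u ≠ z ∧ v ≠ z
  symm := ⟨fun _ _ h => ⟨h.1.symm, h.2.2, h.2.1⟩⟩
  loopless := ⟨fun _ h => h.1 rfl⟩

section cliqueWithIsolated

variable (z : V)

theorem neighborFinset_cliqueWithIsolated (v : V) :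
    (cliqueWithIsolated z).neighborFinset v = if v = z then ∅ else (univ.erase z).erase v := by
  ext u
  rw [SimpleGraph.mem_neighborFinset]
  split_ifs <;> simp [cliqueWithIsolated] <;> grind

theorem degree_cliqueWithIsolated (v : V) :
    (cliqueWithIsolated z).degree v = if v = z then 0 else Fintype.card V - 2 := by
  rw [← SimpleGraph.card_neighborFinset_eq_degree, neighborFinset_cliqueWithIsolated]
  split_ifs with h
  · rfl
  · rw [card_erase_of_mem (by grind), card_erase_of_mem (mem_univ z), card_univ]
    omega

theorem two_mul_ncard_edgeSet_cliqueWithIsolated :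
    2 * (cliqueWithIsolated z).edgeSet.ncard = (Fintype.card V - 1) * (Fintype.card V - 2) := by
  rw [← sum_degree_eq (cliqueWithIsolated z) rfl, ← add_sum_erase univ _ (mem_univ z),
    degree_cliqueWithIsolated, if_pos rfl, zero_add,
    sum_congr rfl (g := fun _ => Fintype.card V - 2) fun v hv => by
      rw [degree_cliqueWithIsolated, if_neg (ne_of_mem_erase hv)],
    sum_const, card_erase_of_mem (mem_univ z), card_univ, smul_eq_mul]

theorem le_alphaSpectralRadius_cliqueWithIsolated (h : 2 ≤ Fintype.card V) :
    (Fintype.card V - 2 : ℝ) ≤ alphaSpectralRadius (1 / 2 : ℝ) (cliqueWithIsolated z) := by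
  rw [show (Fintype.card V - 2 : ℝ) = (2 * (Fintype.card V - 2 : ℕ) : ℝ) / 2 by
    rw [Nat.cast_sub h]; push_cast; ring]
  refine le_alphaSpectralRadius_half _ _ (fun v => if v = z then 0 else 1) (fun h0 => ?_)
    fun v => ?_
  · obtain ⟨y, hy⟩ := Fintype.exists_ne_of_one_lt_card (by omega) z
    simpa [hy] using congrFun h0 y
  · by_cases hv : v = z
    · simp [hv, neighborFinset_cliqueWithIsolated]
    · have hsum : ∑ u ∈ (cliqueWithIsolated z).neighborFinset v, (if u = z then (0 : ℝ) else 1) =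
          (cliqueWithIsolated z).degree v := by
        rw [← SimpleGraph.card_neighborFinset_eq_degree, card_eq_sum_ones, Nat.cast_sum]
        refine sum_congr rfl fun u hu => ?_
        rw [SimpleGraph.mem_neighborFinset] at hu
        simp [hu.2.2]
      rw [hsum, degree_cliqueWithIsolated]
      simp only [hv, if_false]
      ring

theorem nonempty_cliqueWithIsolated_iso (m : ℕ) (h : Fintype.card V = m + 1) :
    Nonempty (cliqueWithIsolated z ≃g (⊤ : SimpleGraph (Fin m)) ⊕g (⊤ : SimpleGraph (Fin 1))) := by
  have h1 : Fintype.card {v // v ≠ z} = m := by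
    simp [Fintype.card_subtype_compl, h]
  have h2 : Fintype.card {v // ¬ v ≠ z} = 1 := by
    simp
  let e : V ≃ Fin m ⊕ Fin 1 := (Equiv.sumCompl fun v => v ≠ z).symm.trans
    (Equiv.sumCongr (Fintype.equivFinOfCardEq h1) (Fintype.equivFinOfCardEq h2))
  refine ⟨e, fun {u v} => ?_⟩
  by_cases hu : u = z <;> by_cases hv : v = z <;>
    simp [e, hu, hv, cliqueWithIsolated]

end cliqueWithIsolated

theorem eq_cliqueWithIsolated (G : SimpleGraph V) {z : V} (hz : G.degree z = 0)
    (hG : 2 * G.edgeSet.ncard = (Fintype.card V - 1) * (Fintype.card V - 2)) :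
    G = cliqueWithIsolated z := by
  refine eq_of_le_of_ncard_edgeSet (fun u v huv => ⟨huv.ne, ?_, ?_⟩) ?_
  · rintro rfl
    exact (G.degree_pos_iff_exists_adj u).2 ⟨v, huv⟩ |>.ne' hz
  · rintro rfl
    exact (G.degree_pos_iff_exists_adj v).2 ⟨u, huv.symm⟩ |>.ne' hz
  · have := two_mul_ncard_edgeSet_cliqueWithIsolated z
    omega

/-! ### Maximizers without isolated vertices. -/

theorem exists_nodup_of_four_le_card (h : 4 ≤ Fintype.card V) :
    ∃ a b c d : V, [a, b, c, d].Nodup := by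
  obtain ⟨f⟩ : Nonempty (Fin 4 ↪ V) :=
    Function.Embedding.nonempty_of_card_le (by simpa using h)
  refine ⟨f 0, f 1, f 2, f 3, ?_⟩
  simp [f.injective.eq_iff]

/-- A spectral radius which is maximal among the graphs with `2 n - 2` edges exceeds every point
at which the characteristic cubic of `K_2 ∨ (K_2 ∪ (n - 4) K_1)` is negative. -/
theorem IsMaximizer.lt_radius {G : SimpleGraph V} {n : ℕ} (hn : 4 ≤ n)
    (hV : Fintype.card V = n) (hG : IsMaximizer (1 / 2 : ℝ) (2 * n - 2) G) {q : ℝ} (hq : 4 ≤ q)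
    (hp : (q - n) * (q - 4) * (q - 2) - 4 * (q - 2) - 2 * (n - 4) * (q - 4) < 0) :
    q / 2 < alphaSpectralRadius (1 / 2 : ℝ) G := by
  obtain ⟨a, b, c, d, h⟩ := exists_nodup_of_four_le_card (V := V) (by omega)
  exact (lt_alphaSpectralRadius_twoHubs h hV hq hp).trans_le
    (hG.2 _ (by rw [ncard_edgeSet_twoHubs h, hV]))

/-- The degree data of a graph with `2 n - 2` edges used in the spectral bounds. -/
theorem neighborDegreeSum_bounds {G : SimpleGraph V} {n k b J : ℕ}
    (hV : Fintype.card V = n) (hn : 4 ≤ n) (hm : G.edgeSet.ncard = 2 * n - 2)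
    (hk : ∀ v, k ≤ G.degree v) (hb : ∀ v, G.degree v ≤ b + 1)
    (hJ : #{v | G.degree v = b + 1} ≤ J) (v : V) :
    (neighborDegreeSum G v : ℝ) + G.degree v + (n - 1 - G.degree v) * k ≤ 4 * n - 4 ∧
    2 * (neighborDegreeSum G v : ℝ) ≤ 4 * n - 4 + G.degree v * (G.degree v - 1) ∧
    (neighborDegreeSum G v : ℝ) ≤ G.degree v * b + J := by
  have hd : G.degree v + 1 ≤ n := by have := G.degree_lt_card_verts v; omega
  refine ⟨?_, ?_, ?_⟩
  · have h := neighborDegreeSum_add_le G hm hk v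
    rw [hV] at h
    obtain ⟨s, rfl⟩ := Nat.exists_eq_add_of_le hd
    rw [show G.degree v + 1 + s - 1 - G.degree v = s by omega] at h
    have h' : neighborDegreeSum G v + G.degree v + s * k + 4 ≤ 4 * (G.degree v + 1 + s) := by
      omega
    have : (neighborDegreeSum G v + G.degree v + s * k + 4 : ℝ) ≤ 4 * (G.degree v + 1 + s) := by
      exact_mod_cast h'
    push_cast
    linarith
  · have h := two_mul_neighborDegreeSum_le G hm v
    rcases Nat.eq_zero_or_pos (G.degree v) with h0 | h0
    · rw [h0] at h ⊢
      have h' : 2 * neighborDegreeSum G v + 4 ≤ 4 * n := by omega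
      have : (2 * neighborDegreeSum G v + 4 : ℝ) ≤ 4 * n := by exact_mod_cast h'
      push_cast
      linarith
    · have h' : 2 * neighborDegreeSum G v + 4 ≤ 4 * n + G.degree v * (G.degree v - 1) := by omega
      have : (2 * neighborDegreeSum G v + 4 : ℝ) ≤ 4 * n + G.degree v * (G.degree v - 1 : ℕ) := by
        exact_mod_cast h'
      rw [Nat.cast_sub h0] at this
      push_cast at this
      linarith
  · exact_mod_cast neighborDegreeSum_le G hb hJ v

theorem exists_ne_of_one_lt_card_dominating {G : SimpleGraph V} {D : ℕ}
    (h : 1 < #{v | G.degree v = D}) : ∃ a b, a ≠ b ∧ G.degree a = D ∧ G.degree b = D := by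
  obtain ⟨a, ha, b, hb, hab⟩ := one_lt_card.1 h
  exact ⟨a, b, hab, by simpa using ha, by simpa using hb⟩

theorem ne_zero_degree_of_dominating {G : SimpleGraph V} {a : V}
    (ha : G.degree a = Fintype.card V - 1) (hV : 2 ≤ Fintype.card V) (v : V) :
    1 ≤ G.degree v := by
  by_cases h : v = a
  · rw [h]; omega
  · exact (G.degree_pos_iff_exists_adj v).2
      ⟨a, ((G.degree_eq_card_sub_one a).1 ha (Ne.symm h)).symm⟩

/-- Without isolated vertices, and with at most one dominating vertex, the row bounds for degrees
in the range `1, …, n - 2` reduce to finitely many inequalities. -/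
theorem radius_le_of_card_dominating_le_one [Nonempty V] {G : SimpleGraph V} {n : ℕ}
    (hV : Fintype.card V = n) (hn : 7 ≤ n) (hm : G.edgeSet.ncard = 2 * n - 2)
    (hk : ∀ v, 1 ≤ G.degree v) (hJ : #{v | G.degree v = n - 1} ≤ 1) {t c : ℝ} (ht : 0 ≤ t)
    (hc : n + 3 / 2 ≤ c) (hc3 : c ≤ n + 3)
    (htop : (n - 1) * (n - 1 + t) + 3 * (n - 1) ≤ c * (n - 1 + t))
    (h1 : n + t ≤ c) (h2 : 2 * n + 1 + t ≤ 2 * c) (h3 : 2 * n + 10 + t ≤ 3 * c)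
    (h4 : 2 * n + 20 + t ≤ 4 * c)
    (hn2 : (n + 3 - c) * (n - 2) - 2 * n + 7 + t ≤ 0) :
    alphaSpectralRadius (1 / 2 : ℝ) G ≤ c / 2 := by
  obtain ⟨b, rfl⟩ : ∃ b, n = b + 2 := ⟨n - 2, by omega⟩
  rw [show b + 2 - 1 = b + 1 by omega] at hJ
  have hb : ∀ v, G.degree v ≤ b + 1 := fun v => by have := G.degree_lt_card_verts v; omega
  have hbd := neighborDegreeSum_bounds hV (by omega) hm hk hb hJ
  have hb5 : (5 : ℝ) ≤ b := by exact_mod_cast (by omega : 5 ≤ b)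
  push_cast at *
  refine alphaSpectralRadius_half_le_of_degree G (b + 1) 1 t c ht (by linarith) (by omega) hJ ?_ ?_
  · intro v hv
    obtain ⟨hA, -, -⟩ := hbd v
    rw [hv] at hA
    push_cast at *
    linarith
  · intro v hv0 hvD
    obtain ⟨hA, hB, hC⟩ := hbd v
    have hdb : G.degree v ≤ b := by have := hb v; omega
    generalize G.degree v = d at *
    generalize (neighborDegreeSum G v : ℝ) = S at *
    -- Degrees 1 and 2 use the bound `d b + 1`, degrees 3 and 4 the double count, and `d ≥ 5` the
    -- bound `S ≤ 3n-3`. In the last case convexity and `c ≤ n + 3` reduce everything to the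
    -- endpoint `d = n - 2`, which is `hn2`.
    by_cases hd : d ≤ 4
    · interval_cases d
      · omega
      all_goals push_cast at *; linarith
    · have hd5 : (5 : ℝ) ≤ d := by exact_mod_cast (by omega : 5 ≤ d)
      have hdb' : (d : ℝ) ≤ b := by exact_mod_cast hdb
      have e1 := mul_nonneg (sub_nonneg.2 hd5) (sub_nonneg.2 hdb')
      have e2 := mul_nonneg (by linarith : (0 : ℝ) ≤ b + 2 + 3 - c) (sub_nonneg.2 hdb')
      push_cast at *
      nlinarith

/-- With at most one dominating vertex, the row bounds hold for some `q` at which the cubic is still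
negative. The window for `q` is narrow, so `q` and `t` are tuned separately for small `n`. -/
theorem exists_twoHubs_of_no_isolated {G : SimpleGraph V} {n : ℕ} (hn : 5 ≤ n) (hn6 : n ≠ 6)
    (hV : Fintype.card V = n) (hG : IsMaximizer (1 / 2 : ℝ) (2 * n - 2) G)
    (hk : ∀ v, 1 ≤ G.degree v) :
    ∃ a b c d, [a, b, c, d].Nodup ∧ G = twoHubs a b c d := by
  have : Nonempty V := Fintype.card_pos_iff.1 (by omega)
  rcases lt_or_ge 1 #{v | G.degree v = n - 1} with hJ | hJ
  · obtain ⟨a, b, hab, ha, hb⟩ := exists_ne_of_one_lt_card_dominating hJ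
    obtain ⟨c, d, h⟩ := exists_eq_twoHubs G (by omega) (by rw [hG.1, hV]) hab
      (by rw [ha, hV]) (by rw [hb, hV])
    exact ⟨a, b, c, d, h⟩
  exfalso
  rcases (by omega : n = 5 ∨ n = 7 ∨ (8 ≤ n ∧ n ≤ 9) ∨ 10 ≤ n) with rfl | rfl | ⟨h8, h9⟩ | h10
  · refine absurd (hG.lt_radius (by norm_num) hV (q := 6.7) (by norm_num) (by norm_num))
      (not_lt.2 ?_)
    have hle : ∀ v, G.degree v ≤ 4 := fun v => by have := G.degree_lt_card_verts v; omega
    have hsum := sum_degree_eq G hG.1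
    -- Degree sum 16 on five vertices with at most one of degree 4 forces the degrees 4, 3, 3, 3, 3.
    have hk3 : ∀ v, 3 ≤ G.degree v := by
      intro v
      by_contra hv
      have h1 : ∑ u, G.degree u ≤
          ∑ u, (3 + (if G.degree u = 4 then 1 else 0) - if u = v then 1 else 0) := by
        refine sum_le_sum fun u _ => ?_
        have := hle u
        by_cases huv : u = v
        · subst huv; simp only [if_true]; split_ifs <;> omega
        · simp only [huv, if_false]; split_ifs <;> omega
      have h2 : ∑ u, (3 + (if G.degree u = 4 then 1 else 0) - if u = v then 1 else 0) +
          ∑ u, (if u = v then 1 else 0) = ∑ u, (3 + (if G.degree u = 4 then 1 else 0)) := by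
        rw [← sum_add_distrib]
        refine sum_congr rfl fun u _ => ?_
        split_ifs <;> omega
      rw [sum_ite_eq', if_pos (mem_univ v), sum_add_distrib, sum_const, card_univ, hV,
        ← card_filter] at h2
      simp only [smul_eq_mul] at h2
      norm_num at hJ hsum
      omega
    have hbd := neighborDegreeSum_bounds hV (by omega) hG.1 hk3 (b := 3) hle hJ
    refine alphaSpectralRadius_half_le_of_degree G 4 1 (1 / 2) 6.7 (by norm_num) (by norm_num)
      (by norm_num) hJ ?_ ?_
    · intro v hv
      obtain ⟨hA, -, -⟩ := hbd v
      rw [hv] at hA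
      norm_num at *
      linarith
    · intro v hv0 hv
      obtain ⟨hA, -, -⟩ := hbd v
      have hv3 : G.degree v = 3 := by have := hle v; have := hk3 v; omega
      rw [hv3] at hA ⊢
      norm_num at *
      linarith
  · refine absurd (hG.lt_radius (by norm_num) hV (q := 8.73) (by norm_num) (by norm_num))
      (not_lt.2 (radius_le_of_card_dominating_le_one hV le_rfl hG.1 hk hJ (t := 3 / 5)
        (by norm_num) ?_ ?_ ?_ ?_ ?_ ?_ ?_ ?_)) <;> norm_num
  · have h8' : (8 : ℝ) ≤ n := by exact_mod_cast h8
    have h9' : (n : ℝ) ≤ 9 := by exact_mod_cast h9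
    refine absurd (hG.lt_radius (by omega) hV (q := n + 1.7) (by linarith) (by nlinarith))
      (not_lt.2 (radius_le_of_card_dominating_le_one hV (by omega) hG.1 hk hJ (t := 1)
        (by norm_num) ?_ ?_ ?_ ?_ ?_ ?_ ?_ ?_)) <;> linarith
  · have h10' : (10 : ℝ) ≤ n := by exact_mod_cast h10
    -- For `t = 3/2` and `c = n + 2 - e`, the dominating row reads `e (2n + 1) ≤ 9`; this `e` makes
    -- it tight.
    obtain ⟨e, he, he0⟩ : ∃ e : ℝ, e * (2 * n + 1) = 9 ∧ 0 ≤ e :=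
      ⟨9 / (2 * n + 1), div_mul_cancel₀ _ (by positivity), by positivity⟩
    have he1 : e ≤ 3 / 7 := by
      by_contra! h
      nlinarith
    have hen : e * n = (9 - e) / 2 := by linarith
    refine absurd (hG.lt_radius (by omega) hV (q := n + 2 - e) (by linarith) ?_)
      (not_lt.2 (radius_le_of_card_dominating_le_one hV (by omega) hG.1 hk hJ (t := 3 / 2)
        (by norm_num) ?_ ?_ ?_ ?_ ?_ ?_ ?_ ?_))
    · have : ((n + 2 - e : ℝ) - n) * (n + 2 - e - 4) * (n + 2 - e - 2) - 4 * (n + 2 - e - 2)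
          - 2 * (n - 4) * (n + 2 - e - 4) =
          -(n / 2) + (9 - e) / 4 + 9 * e - e ^ 2 - e ^ 3 - 16 := by
        linear_combination (-n + 1 / 2 + 2 * e) * hen
      rw [this]
      nlinarith [pow_nonneg he0 2, pow_nonneg he0 3]
    all_goals nlinarith

/-- Three dominating vertices would need degree sum at least `3·5 + 3·3 = 24 > 20`, so at most two
occur. The weights then allow `c = 7.97`, just below the value 8 attained by `K_5 ∪ K_1`. -/
theorem radius_lt_four_of_no_isolated {G : SimpleGraph V} (hV : Fintype.card V = 6)
    (hm : G.edgeSet.ncard = 10) (hk : ∀ v, 1 ≤ G.degree v) :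
    alphaSpectralRadius (1 / 2 : ℝ) G < 4 := by
  have : Nonempty V := Fintype.card_pos_iff.1 (by omega)
  have hle : ∀ v, G.degree v ≤ 5 := fun v => by have := G.degree_lt_card_verts v; omega
  have hJ : #{v | G.degree v = 5} ≤ 2 := by
    have h := card_mul_le_sum_degree G (subset_univ ({v | G.degree v = 5} : Finset V))
      fun f hf u _ huf => by
        have hf5 : G.degree f = Fintype.card V - 1 := by rw [hV]; simpa using hf
        exact (G.degree_eq_card_sub_one f).1 hf5 huf.symm
    have h6 := card_le_univ ({v | G.degree v = 5} : Finset V)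
    rw [sum_degree_eq G hm, card_univ, hV] at h
    rw [hV] at h6
    generalize #{v | G.degree v = 5} = F at *
    interval_cases F <;> omega
  have hbd := neighborDegreeSum_bounds hV (by norm_num) hm hk (b := 4) hle hJ
  refine (alphaSpectralRadius_half_le_of_degree G 5 2 (1 / 10) 7.97 (by norm_num) (by norm_num)
    (by norm_num) hJ ?_ ?_).trans_lt (by norm_num)
  · intro v hv
    obtain ⟨hA, -, -⟩ := hbd v
    rw [hv] at hA
    norm_num at *
    linarith
  · intro v hv0 hvD
    obtain ⟨hA, hB, hC⟩ := hbd v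
    have hd := hle v
    generalize G.degree v = d at *
    generalize (neighborDegreeSum G v : ℝ) = S at *
    interval_cases d
    · omega
    all_goals first | omega | (norm_num at *; linarith)

/-! ### Excluding isolated vertices. -/

theorem degree_le_of_isolated {G : SimpleGraph V} {z : V} (hz : G.degree z = 0) (v : V) :
    G.degree v ≤ Fintype.card V - 2 := by
  by_cases hv : v = z
  · rw [hv, hz]; exact Nat.zero_le _
  rw [← G.card_neighborFinset_eq_degree, ← card_pair hv, ← card_univ,
    ← card_sdiff_of_subset (subset_univ _)]
  refine card_le_card fun u hu => mem_sdiff.2 ⟨mem_univ u, ?_⟩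
  rw [G.mem_neighborFinset] at hu
  have : u ≠ z := by
    rintro rfl
    exact ((G.degree_pos_iff_exists_adj u).2 ⟨v, hu.symm⟩).ne' hz
  simp [hu.ne', this]

theorem IsMaximizer.no_isolated {G : SimpleGraph V} {n : ℕ} (hn : 5 ≤ n) (hn6 : n ≠ 6)
    (hV : Fintype.card V = n) (hG : IsMaximizer (1 / 2 : ℝ) (2 * n - 2) G) (z : V) :
    1 ≤ G.degree z := by
  have : Nonempty V := ⟨z⟩
  by_contra hz
  replace hz : G.degree z = 0 := by omega
  have hle : ∀ v, G.degree v ≤ n - 2 := hV ▸ degree_le_of_isolated hz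
  rcases (by omega : n = 5 ∨ n = 7 ∨ 8 ≤ n) with rfl | rfl | h8
  · have hsum := sum_degree_eq G hG.1
    rw [← add_sum_erase univ _ (mem_univ z), hz] at hsum
    have := sum_le_card_nsmul (univ.erase z) (fun v => G.degree v) 3 fun v _ => hle v
    rw [card_erase_of_mem (mem_univ z), card_univ, hV, smul_eq_mul] at this
    omega
  · refine absurd (hG.lt_radius (by norm_num) hV (q := 8.73) (by norm_num) (by norm_num))
      (not_lt.2 ?_)
    -- A vertex of degree 5 is joined to all other non-isolated candidates; four of them would need
    -- degree sum `4·5 + 2·4 = 28 > 24`.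
    have hJ : #{v | G.degree v = 5} ≤ 3 := by
      have hFU : ({v | G.degree v = 5} : Finset V) ⊆ univ.erase z := fun v hv => by
        have hv5 : G.degree v = 5 := by simpa using hv
        refine mem_erase.2 ⟨?_, mem_univ v⟩
        rintro rfl
        omega
      have h := card_mul_le_sum_degree G hFU fun f hf u hu huf => by
        have hf5 : G.degree f = 5 := by simpa using hf
        have hsub : G.neighborFinset f ⊆ (univ.erase z).erase f := fun w hw => by
          rw [G.mem_neighborFinset] at hw
          refine mem_erase.2 ⟨hw.ne', mem_erase.2 ⟨?_, mem_univ w⟩⟩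
          rintro rfl
          exact ((G.degree_pos_iff_exists_adj w).2 ⟨f, hw.symm⟩).ne' hz
        have heq := eq_of_subset_of_card_le hsub (by
          rw [card_erase_of_mem (hFU hf), card_erase_of_mem (mem_univ z), card_univ, hV,
            G.card_neighborFinset_eq_degree, hf5])
        rw [← G.mem_neighborFinset, heq]
        exact mem_erase.2 ⟨huf, hu⟩
      have h6 := card_le_card hFU
      rw [card_erase_of_mem (mem_univ z), card_univ, hV] at h6
      rw [sum_degree_eq G hG.1, card_erase_of_mem (mem_univ z), card_univ, hV] at h
      generalize #{v | G.degree v = 5} = F at *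
      interval_cases F <;> omega
    have hbd := neighborDegreeSum_bounds hV (by norm_num) hG.1 (fun v => Nat.zero_le _)
      (b := 4) hle hJ
    -- For degrees 1 and 2 this is sharper than `4 d + 3`.
    have hbd' : ∀ v, neighborDegreeSum G v ≤ G.degree v * 5 + 0 :=
      neighborDegreeSum_le G (fun v => (hle v).trans (by norm_num)) (by
        rw [Nat.le_zero, card_eq_zero, filter_eq_empty_iff]
        intro v _ hv
        have := hle v
        omega)
    refine alphaSpectralRadius_half_le_of_degree G 5 3 (1 / 4) 8.73 (by norm_num) (by norm_num)
      (by norm_num) hJ ?_ ?_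
    · intro v hv
      obtain ⟨hA, -, -⟩ := hbd v
      rw [hv] at hA
      norm_num at *
      linarith
    · intro v hv0 hvD
      obtain ⟨hA, hB, -⟩ := hbd v
      have hC : (neighborDegreeSum G v : ℝ) ≤ G.degree v * 5 := by exact_mod_cast hbd' v
      have hd : G.degree v ≤ 5 := hle v
      generalize G.degree v = d at *
      generalize (neighborDegreeSum G v : ℝ) = S at *
      interval_cases d <;> first | omega | (norm_num at *; linarith)
  · obtain ⟨b, rfl⟩ : ∃ b, n = b + 2 := ⟨n - 2, by omega⟩
    have hb6 : (6 : ℝ) ≤ b := by exact_mod_cast (by omega : 6 ≤ b)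
    refine absurd (hG.lt_radius (by omega) hV (q := b + 2 + 1.7) (by linarith)
      (by push_cast; nlinarith)) (not_lt.2 ?_)
    have hJ : #{v | G.degree v = b + 1} ≤ 0 := by
      rw [Nat.le_zero, card_eq_zero, filter_eq_empty_iff]
      intro v _ hv
      have := hle v
      omega
    have hbd := neighborDegreeSum_bounds hV (by omega) hG.1 (fun v => Nat.zero_le _)
      (b := b) (fun v => (hle v).trans (by omega)) hJ
    -- Degree `b + 1 = n - 1` does not occur, so these are the plain degree weights.
    refine alphaSpectralRadius_half_le_of_degree G (b + 1) 0 0 (b + 2 + 1.7) le_rfl (by linarith)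
      (by omega) hJ ?_ ?_
    · intro v hv
      have := hle v
      omega
    · intro v hv0 _
      obtain ⟨hA, hB, hC⟩ := hbd v
      have hdb : G.degree v ≤ b := hle v
      generalize G.degree v = d at *
      generalize (neighborDegreeSum G v : ℝ) = S at *
      push_cast at *
      by_cases hd : d ≤ 4
      · interval_cases d
        · omega
        all_goals push_cast at *; linarith
      · have hd5 : (5 : ℝ) ≤ d := by exact_mod_cast (by omega : 5 ≤ d)
        have hdb' : (d : ℝ) ≤ b := by exact_mod_cast hdb
        nlinarith [mul_nonneg (sub_nonneg.2 hd5) (sub_nonneg.2 hdb')]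

/-! ### Parameters of the quasi-star. -/

theorem ncard_edgeSet_top :
    (⊤ : SimpleGraph V).edgeSet.ncard = (Fintype.card V).choose 2 := by
  rw [← SimpleGraph.card_edgeFinset_top_eq_card_choose_two, Set.ncard_eq_toFinset_card']
  congr! 1

theorem quasiStarK_eq_two {n : ℕ} (hn : 5 ≤ n) : quasiStarK n (2 * n - 2) = 2 := by
  rw [quasiStarK, Nat.findGreatest_eq_iff]
  refine ⟨by omega, fun _ => ?_, fun {k} hk _ => ?_⟩
  · rw [show Icc 1 2 = {1, 2} from rfl, sum_pair (by norm_num)]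
    omega
  -- Three hubs use `3n - 6` edges, more than `2n - 2` exactly when `n > 4`; hence `n = 4` is
  -- treated apart.
  · have h : ∑ i ∈ Icc 1 3, (n - i) ≤ ∑ i ∈ Icc 1 k, (n - i) :=
      sum_le_sum_of_subset (Icc_subset_Icc_right hk)
    rw [show Icc 1 3 = {1, 2, 3} from rfl, sum_insert (by decide), sum_pair (by norm_num)] at h
    omega

theorem quasiStarA_eq_one {n : ℕ} (hn : 5 ≤ n) : quasiStarA n (2 * n - 2) = 1 := by
  rw [quasiStarA, quasiStarK_eq_two hn, show Icc 1 2 = {1, 2} from rfl, sum_pair (by norm_num)]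
  omega

/-- The vertex type of `quasiStar` depends on both parameters, so their values are inserted by
substitution into `joinStar`. -/
theorem nonempty_iso_quasiStar_iff {W : Type*} (G : SimpleGraph W) {n m k a : ℕ}
    (hk : quasiStarK n m = k) (ha : quasiStarA n m = a) :
    Nonempty (G ≃g quasiStar n m) ↔ Nonempty (G ≃g joinStar n k a) := by
  subst hk ha
  rfl

end

end AlphaSpectral

theorem theorem1p2 {V : Type*} [Fintype V] (n : ℕ) (hn : 4 ≤ n) (hV : Fintype.card V = n)
    (G : SimpleGraph V) (hG : AlphaSpectral.IsMaximizer (1 / 2 : ℝ) (2 * n - 2) G) :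
    (n = 6 → Nonempty (G ≃g (⊤ : SimpleGraph (Fin 5)) ⊕g (⊤ : SimpleGraph (Fin 1)))) ∧
    (n ≠ 6 → Nonempty (G ≃g AlphaSpectral.quasiStar n (2 * n - 2))) := by
  classical
  open AlphaSpectral in
  refine ⟨?_, fun hn6 => ?_⟩
  · rintro rfl
    obtain ⟨z⟩ : Nonempty V := Fintype.card_pos_iff.1 (by omega)
    by_cases hz : ∃ z, G.degree z = 0
    · obtain ⟨z, hz⟩ := hz
      rw [eq_cliqueWithIsolated G (z := z) (by convert hz) (by rw [hG.1, hV])]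
      exact nonempty_cliqueWithIsolated_iso z 5 hV
    · push Not at hz
      have h1 := radius_lt_four_of_no_isolated hV hG.1
        (fun v => Nat.one_le_iff_ne_zero.2 (by convert hz v))
      have h2 := le_alphaSpectralRadius_cliqueWithIsolated z (by omega)
      have h3 := hG.2 (cliqueWithIsolated z) (by
        have := two_mul_ncard_edgeSet_cliqueWithIsolated z
        rw [hV] at this
        omega)
      rw [hV] at h2
      norm_num at h1 h2 h3
      linarith
  · rcases hn.eq_or_lt with rfl | hn5
    · rw [nonempty_iso_quasiStar_iff G (k := 3) (a := 0) (by decide) (by decide),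
        eq_of_le_of_ncard_edgeSet (le_top : G ≤ ⊤)]
      · exact nonempty_top_iso_joinStar hV
      · rw [hG.1, ncard_edgeSet_top, hV]
        rfl
    · rw [nonempty_iso_quasiStar_iff G (quasiStarK_eq_two hn5) (quasiStarA_eq_one hn5)]
      obtain ⟨a, b, c, d, h, rfl⟩ :=
        exists_twoHubs_of_no_isolated hn5 hn6 hV hG (hG.no_isolated hn5 hn6 hV)
      exact hV ▸ nonempty_twoHubs_iso_joinStar h
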